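/- **The calculus.** Ordinary variables $x,y,\dots$ and continuation variables $k,l,\dots$ are two disjoint sorts. Terms $M$ and jumps $J$ of the CCV $\lambda\mu$-calculus are given by $$M ::= x \mid \lambda x.\,M \mid M\,M \mid M\lceil x:=M\rceil \mid \mu k.\,J,\qquad J ::= [k]M \mid J\lceil x:=M\rceil ,$$ where $L\lceil x:=M\rceil$ (let $x=M$ in $L$) binds $x$ in $L$, and terms are taken up to $\alpha$-conversion. Expressions are moreover identified by the least congruence containing - $L\lceil x:=M\lceil y:=N\rceil\rceil = L\lceil x:=M\rceil\lceil y:=N\rceil$ if $y\notin FV(L)$, - $(\mu k.J)\lceil x:=M\rceil = \mu k.(J\lceil x:=M\rceil)$ if $k\notin FV(M)$, - $[k](L\lceil x:=M\rceil)=([k]L)\lceil x:=M\rceil$. Values $V$ are variables and abstractions. Reduction $\to$ is the closure under all contexts of - $NM\to (zM)\lceil z:=N\rceil$ ($N$ a non-value, $z$ fresh); - $VN\to (Vz)\lceil z:=N\rceil$ ($N$ a non-value, $z$ fresh); - $(\lambda x.M)V\to M\lceil x:=V\rceil$; - $M\lceil x:=V\rceil\to M\{V/x\}$; - $M\lceil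 x:=\mu k.J\rceil\to \mu k.\,J\{[k]\square\mapsto[k](M\lceil x:=\square\rceil)\}$; - $[l]\mu k.J\to J\{l/k\}$; - $\lambda x.Vx\to V$ ($x\notin FV(V)$); - $x\lceil x:=M\rceil\to M$; - $\mu k.[k]M\to M$ ($k\notin FV(M)$). $L\to^* M$ means that $M$ is obtained from $L$ by finitely many reductions, identified expressions being interchangeable. **Types.** Raw types $R::=\alpha\mid S\to T$ ($\alpha$ atomic), subsidiary types $S::=R_1\cap\dots\cap R_n$, types $T::=S_1\cup\dots\cup S_n$, with $n\ge 0$, up to associativity and commutativity of $\cap$ and $\cup$. The empty intersection is $\omega$ and the empty union is $\mho$. The relation $\le$ is generated by: $\alpha\le\alpha$; $S\to T\le S'\to T'$ if $S'\le S$ and $T\le T'$; $S\cap S''\le S'$ if $S\le S'$; $S\le\bigcap_i S_i$ if $S\le S_i$ for all $i$; $T\le T''\cup T'$ if $T\le T'$; $\bigcup_i T_i\le T$ if $T_i\le T$ for all $i$ (finite, possibly empty families). **Typing.** A judgement $\Gamma\vdash M:T\mid\Delta$ has a finite environment $\Gamma$ of declarations $x:S$ and a finite environment $\Delta$ of declarations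 $k:T$. A variable that is not declared is regarded as declared by $x:\omega$, respectively $k:\mho$. Jumps have the special type $\bot\!\!\!\bot$. The rules (all families finite, possibly empty) are - $\Gamma,x:S\vdash x:S\mid\Delta$; - from $\Gamma,x:S_i\vdash M:T_i\mid\Delta$ for all $i$ infer $\Gamma\vdash\lambda x.M:\bigcap_i(S_i\to T_i)\mid\Delta$; - from $\Gamma\vdash M:\bigcup_i\bigcap_j(S_{ij}\to T)\mid\Delta$ and $\Gamma\vdash N:\bigcup_j S_{ij}\mid\Delta$ for all $i$ infer $\Gamma\vdash MN:T\mid\Delta$; - from $\Gamma,x:S_i\vdash M:T\mid\Delta$ for all $i$ and $\Gamma\vdash N:\bigcup_iS_i\mid\Delta$ infer $\Gamma\vdash M\lceil x:=N\rceil:T\mid\Delta$, and likewise for a jump $J$ and $\bot\!\!\!\bot$ in place of $M$ and $T$; - from $\Gamma\vdash J:\bot\!\!\!\bot\mid\Delta,k:T$ infer $\Gamma\vdash\mu k.J:T\mid\Delta$; - from $\Gamma\vdash M:T\mid\Delta,k:T$ infer $\Gamma\vdash[k]M:\bot\!\!\!\bot\mid\Delta,k:T$; - from $\Gamma\vdash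 M:T\mid\Delta$ and $T\le T'$ infer $\Gamma\vdash M:T'\mid\Delta$. **Theorem.** Let $L,M$ be terms with $L\to^*M$. 1. If $\Gamma\vdash L:T\mid\Delta$, then $\Gamma\vdash M:T\mid\Delta$. 2. If $\Gamma\vdash M:T\mid\Delta$, then there are $\Gamma',\Delta'$ and $T'$ such that $\Gamma'\vdash L:T'\mid\Delta'$. -/

import Mathlib

namespace CCV

/-! ### Expressions

Expressions are written with de Bruijn indices, so that alpha-convertible expressions are equal.
Ordinary variables and continuation variables are indexed separately: `lam` and the body of
`letIn` bind the ordinary variable `0`, and `mu` binds the continuation variable `0`. -/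

/-- The two syntactic categories: terms and jumps. -/
inductive Kind : Type
  | term
  | jump

/-- Terms `M ::= x | λx.M | M M | M⌈x := M⌉ | μk.J` and jumps `J ::= [k]M | J⌈x := M⌉`.
The expression `letIn L M` is the let-construct `L⌈x := M⌉` (that is, `let x = M in L`); the
variable `x` is bound in `L`, which is a term or a jump. -/
inductive Expr : Kind → Type
  | var (i : ℕ) : Expr .term
  | lam (M : Expr .term) : Expr .term
  | app (M N : Expr .term) : Expr .term
  | letIn {s : Kind} (L : Expr s) (M : Expr .term) : Expr s
  | mu (J : Expr .jump) : Expr .term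
  | jmp (k : ℕ) (M : Expr .term) : Expr .jump

/-- A renaming pushed under one binder. -/
def liftRen (ξ : ℕ → ℕ) : ℕ → ℕ
  | 0 => 0
  | n + 1 => ξ n + 1

namespace Expr

/-- Renaming of the free ordinary variables. -/
def rename : {s : Kind} → (ℕ → ℕ) → Expr s → Expr s
  | _, ξ, var i => var (ξ i)
  | _, ξ, lam M => lam (rename (liftRen ξ) M)
  | _, ξ, app M N => app (rename ξ M) (rename ξ N)
  | _, ξ, letIn L M => letIn (rename (liftRen ξ) L) (rename ξ M)
  | _, ξ, mu J => mu (rename ξ J)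
  | _, ξ, jmp k M => jmp k (rename ξ M)

/-- Renaming of the free continuation variables. -/
def renameK : {s : Kind} → (ℕ → ℕ) → Expr s → Expr s
  | _, _, var i => var i
  | _, ζ, lam M => lam (renameK ζ M)
  | _, ζ, app M N => app (renameK ζ M) (renameK ζ N)
  | _, ζ, letIn L M => letIn (renameK ζ L) (renameK ζ M)
  | _, ζ, mu J => mu (renameK (liftRen ζ) J)
  | _, ζ, jmp k M => jmp (ζ k) (renameK ζ M)

/-- An expression weakened by a fresh ordinary variable `0`. -/
def shift {s : Kind} (M : Expr s) : Expr s := rename Nat.succ M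

/-- An expression weakened by a fresh continuation variable `0`. -/
def shiftK {s : Kind} (M : Expr s) : Expr s := renameK Nat.succ M

/-- A substitution pushed under a binder of an ordinary variable. -/
def liftSubst (σ : ℕ → Expr .term) : ℕ → Expr .term
  | 0 => var 0
  | n + 1 => shift (σ n)

/-- Simultaneous capture-avoiding substitution for the free ordinary variables. -/
def subst : {s : Kind} → (ℕ → Expr .term) → Expr s → Expr s
  | _, σ, var i => σ i
  | _, σ, lam M => lam (subst (liftSubst σ) M)
  | _, σ, app M N => app (subst σ M) (subst σ N)
  | _, σ, letIn L M => letIn (subst (liftSubst σ) L) (subst σ M)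
  | _, σ, mu J => mu (subst (fun n => shiftK (σ n)) J)
  | _, σ, jmp k M => jmp k (subst σ M)

/-- `inst V M` is `M{V/x}`, where `x` is the ordinary variable `0` of `M`. -/
def inst {s : Kind} (V : Expr .term) (M : Expr s) : Expr s :=
  subst (fun | 0 => V | n + 1 => var n) M

/-- `instK l J` is `J{l/k}`, where `k` is the continuation variable `0` of `J`. -/
def instK {s : Kind} (l : ℕ) (J : Expr s) : Expr s :=
  renameK (fun | 0 => l | n + 1 => n) J

/-- `capture k M J` is the context substitution `J{[k]□ ↦ [k](M⌈x := □⌉)}`, performed recursively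
and without capture; `x` is the ordinary variable `0` of `M`. -/
def capture : {s : Kind} → ℕ → Expr .term → Expr s → Expr s
  | _, _, _, var i => var i
  | _, k, M, lam N => lam (capture k (rename (liftRen Nat.succ) M) N)
  | _, k, M, app N P => app (capture k M N) (capture k M P)
  | _, k, M, letIn L N => letIn (capture k (rename (liftRen Nat.succ) M) L) (capture k M N)
  | _, k, M, mu J => mu (capture (k + 1) (shiftK M) J)
  | _, k, M, jmp l Q => if l = k then jmp l (letIn M (capture k M Q)) else jmp l (capture k M Q)

/-- Values are variables and lambda abstractions. -/
def IsValue : {s : Kind} → Expr s → Prop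
  | _, var _ => True
  | _, lam _ => True
  | _, _ => False

end Expr

open _root_.CCV.Expr

/-- The identification of expressions: the smallest congruence containing the three equality axioms
for let. -/
inductive Eqv : {s : Kind} → Expr s → Expr s → Prop
  /-- `L⌈x := M⌈y := N⌉⌉ = L⌈x := M⌉⌈y := N⌉` if `y` is not free in `L`. -/
  | assoc (L M N : Expr .term) :
      Eqv (letIn L (letIn M N)) (letIn (letIn (rename (liftRen Nat.succ) L) M) N)
  /-- `(μk.J)⌈x := M⌉ = μk.(J⌈x := M⌉)` if `k` is not free in `M`. -/
  | muLet (J : Expr .jump) (M : Expr .term) :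
      Eqv (letIn (mu J) M) (mu (letIn J (shiftK M)))
  /-- `[k](L⌈x := M⌉) = ([k]L)⌈x := M⌉`. -/
  | jmpLet (k : ℕ) (L M : Expr .term) :
      Eqv (jmp k (letIn L M)) (letIn (jmp k L) M)
  | refl {s : Kind} (M : Expr s) : Eqv M M
  | symm {s : Kind} {M N : Expr s} : Eqv M N → Eqv N M
  | trans {s : Kind} {M N P : Expr s} : Eqv M N → Eqv N P → Eqv M P
  | lam {M M' : Expr .term} : Eqv M M' → Eqv (lam M) (lam M')
  | app {M M' N N' : Expr .term} : Eqv M M' → Eqv N N' → Eqv (app M N) (app M' N')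
  | letIn {s : Kind} {L L' : Expr s} {M M' : Expr .term} :
      Eqv L L' → Eqv M M' → Eqv (letIn L M) (letIn L' M')
  | mu {J J' : Expr .jump} : Eqv J J' → Eqv (mu J) (mu J')
  | jmp (k : ℕ) {M M' : Expr .term} : Eqv M M' → Eqv (jmp k M) (jmp k M')

/-- One-step reduction: the reduction rules, applied anywhere in an expression. -/
inductive Step : {s : Kind} → Expr s → Expr s → Prop
  /-- `N M → (z M)⌈z := N⌉`, `N` a non-value, `z` fresh. -/
  | ad₁ (N M : Expr .term) : ¬ IsValue N →
      Step (app N M) (letIn (app (var 0) (shift M)) N)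
  /-- `V N → (V z)⌈z := N⌉`, `V` a value, `N` a non-value, `z` fresh. -/
  | ad₂ (V N : Expr .term) : IsValue V → ¬ IsValue N →
      Step (app V N) (letIn (app (shift V) (var 0)) N)
  /-- `(λx.M) V → M⌈x := V⌉`. -/
  | betaLam (M V : Expr .term) : IsValue V → Step (app (lam M) V) (letIn M V)
  /-- `M⌈x := V⌉ → M{V/x}`. -/
  | betaLet (M V : Expr .term) : IsValue V → Step (letIn M V) (inst V M)
  /-- `M⌈x := μk.J⌉ → μk.J{[k]□ ↦ [k](M⌈x := □⌉)}`. -/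
  | betaMu (M : Expr .term) (J : Expr .jump) :
      Step (letIn M (mu J)) (mu (capture 0 (shiftK M) J))
  /-- `[l]μk.J → J{l/k}`. -/
  | betaJmp (l : ℕ) (J : Expr .jump) : Step (jmp l (mu J)) (instK l J)
  /-- `λx.V x → V`, `x` not free in `V`. -/
  | etaLam (V : Expr .term) : IsValue V → Step (lam (app (shift V) (var 0))) V
  /-- `x⌈x := M⌉ → M`. -/
  | etaLet (M : Expr .term) : Step (letIn (var 0) M) M
  /-- `μk.[k]M → M`, `k` not free in `M`. -/
  | etaMu (M : Expr .term) : Step (mu (jmp 0 (shiftK M))) M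
  | lam {M M' : Expr .term} : Step M M' → Step (lam M) (lam M')
  | appL {M M' : Expr .term} (N : Expr .term) : Step M M' → Step (app M N) (app M' N)
  | appR (M : Expr .term) {N N' : Expr .term} : Step N N' → Step (app M N) (app M N')
  | letL {s : Kind} {L L' : Expr s} (M : Expr .term) : Step L L' → Step (letIn L M) (letIn L' M)
  | letR {s : Kind} (L : Expr s) {M M' : Expr .term} : Step M M' → Step (letIn L M) (letIn L M')
  | mu {J J' : Expr .jump} : Step J J' → Step (mu J) (mu J')
  | jmp (k : ℕ) {M M' : Expr .term} : Step M M' → Step (jmp k M) (jmp k M')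

/-- `L →* M`: reduction in any finite number of steps, where identified expressions may be
exchanged for each other at any point. -/
def Reduces {s : Kind} : Expr s → Expr s → Prop :=
  Relation.ReflTransGen fun L M => Eqv L M ∨ Step L M

/-! ### Types -/

/-- Raw types `R ::= α | S → T` over a set `A` of atomic types. A subsidiary type is a finite
intersection of raw types and a type is a finite union of subsidiary types; both are lists. -/
inductive RawTy (A : Type*) : Type _
  | atom (a : A) : RawTy A
  | arrow (S : List (RawTy A)) (T : List (List (RawTy A))) : RawTy A

/-- Subsidiary types `R₁ ∩ ⋯ ∩ Rₙ`; the empty list is `ω`. -/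
abbrev SubTy (A : Type*) := List (RawTy A)

/-- Types `S₁ ∪ ⋯ ∪ Sₙ`; the empty list is the empty union. A subsidiary type `S` is regarded as
the type `[S]`, and a raw type `R` as the subsidiary type `[R]`. -/
abbrev Ty (A : Type*) := List (SubTy A)

/-- The subtype relation. Lists make `∩` and `∪` associative; the premises on permutations and
sub-permutations (`S₀` is `S ∩ S''` up to order) make them commutative. -/
inductive Subtype {A : Type*} : Ty A → Ty A → Prop
  | atom (a : A) : Subtype [[.atom a]] [[.atom a]]
  | arrow {S S' : SubTy A} {T T' : Ty A} : Subtype [S'] [S] → Subtype T T' →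
      Subtype [[.arrow S T]] [[.arrow S' T']]
  | interL {S₀ S S' : SubTy A} : S.Subperm S₀ → Subtype [S] [S'] → Subtype [S₀] [S']
  | interR {S S₀ : SubTy A} (Ss : List (SubTy A)) : S₀.Perm Ss.flatten →
      (∀ Sᵢ ∈ Ss, Subtype [S] [Sᵢ]) → Subtype [S] [S₀]
  | unionR {T T' T₀ : Ty A} : T'.Subperm T₀ → Subtype T T' → Subtype T T₀
  | unionL {T₀ T : Ty A} (Ts : List (Ty A)) : T₀.Perm Ts.flatten →
      (∀ Tᵢ ∈ Ts, Subtype Tᵢ T) → Subtype T₀ T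

/-- What an expression is assigned: a type for a term, the special type `⊥⊥` for a jump. -/
inductive JTy (A : Type*) : Kind → Type _
  | ty (T : Ty A) : JTy A .term
  | bot : JTy A .jump

/-- Typing judgements `Γ ⊢ M : τ | Δ`. The `i`-th entry of `Γ` is the subsidiary type of the
ordinary variable `i`, and the `k`-th entry of `Δ` is the type of the continuation variable `k`.
A variable for which there is no entry counts as declared with `ω` (ordinary variables) or the empty
union (continuation variables), i.e. with the empty list. -/
inductive Typing {A : Type*} :
    List (SubTy A) → {s : Kind} → Expr s → JTy A s → List (Ty A) → Prop
  | var (Γ : List (SubTy A)) (Δ : List (Ty A)) (i : ℕ) :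
      Typing Γ (.var i) (.ty [Γ.getD i []]) Δ
  /-- From `Γ, x : Sᵢ ⊢ M : Tᵢ | Δ` for all `i` infer `Γ ⊢ λx.M : ⋂ᵢ (Sᵢ → Tᵢ) | Δ`. -/
  | lam {Γ : List (SubTy A)} {Δ : List (Ty A)} {M : Expr .term} (P : List (SubTy A × Ty A)) :
      (∀ p ∈ P, Typing (p.1 :: Γ) M (.ty p.2) Δ) →
      Typing Γ (.lam M) (.ty [P.map fun p => .arrow p.1 p.2]) Δ
  /-- From `Γ ⊢ M : ⋃ᵢ ⋂ⱼ (Sᵢⱼ → T) | Δ` and `Γ ⊢ N : ⋃ⱼ Sᵢⱼ | Δ` for all `i` infer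
  `Γ ⊢ M N : T | Δ`. The list `U` consists of the lists `(Sᵢⱼ)ⱼ`. -/
  | app {Γ : List (SubTy A)} {Δ : List (Ty A)} {M N : Expr .term} {T : Ty A}
      (U : List (List (SubTy A))) :
      Typing Γ M (.ty (U.map fun Si => Si.map fun Sij => .arrow Sij T)) Δ →
      (∀ Si ∈ U, Typing Γ N (.ty Si) Δ) →
      Typing Γ (.app M N) (.ty T) Δ
  /-- From `Γ, x : Sᵢ ⊢ L : τ | Δ` for all `i` and `Γ ⊢ N : ⋃ᵢ Sᵢ | Δ` infer
  `Γ ⊢ L⌈x := N⌉ : τ | Δ`, for terms and for jumps `L`. -/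
  | letIn {Γ : List (SubTy A)} {Δ : List (Ty A)} {s : Kind} {L : Expr s} {N : Expr .term}
      {τ : JTy A s} (Ss : List (SubTy A)) :
      (∀ Sᵢ ∈ Ss, Typing (Sᵢ :: Γ) L τ Δ) →
      Typing Γ N (.ty Ss) Δ →
      Typing Γ (.letIn L N) τ Δ
  | mu {Γ : List (SubTy A)} {Δ : List (Ty A)} {J : Expr .jump} {T : Ty A} :
      Typing Γ J .bot (T :: Δ) → Typing Γ (.mu J) (.ty T) Δ
  | jmp {Γ : List (SubTy A)} {Δ : List (Ty A)} {M : Expr .term} (k : ℕ) :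
      Typing Γ M (.ty (Δ.getD k [])) Δ → Typing Γ (.jmp k M) .bot Δ
  /-- The inheritance rule. -/
  | inherit {Γ : List (SubTy A)} {Δ : List (Ty A)} {M : Expr .term} {T T' : Ty A} :
      Typing Γ M (.ty T) Δ → Subtype T T' → Typing Γ M (.ty T') Δ

end CCV

/-! Typing is first made syntax-directed. `Assigns` is defined by recursion on expressions, takes
environments as functions, and absorbs the inheritance rule; since subtyping is transitive, it
agrees with `Typing`. Each identification and each reduction rule can then be checked by unfolding
clauses, and all but one leave the assigned types unchanged in both directions.

Two rules have real content, and they are dual. For `M⌈x := V⌉ → M{V/x}`, the copies of `V` may be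
used at several types, and `x` receives their intersection; this works because values are closed
under finite intersections and inhabit a union only through one of its members (`Assigns.of_subst`).
For `M⌈x := μk.J⌉`, the jumps to `k` may carry several types, and `k` receives their union
(`Assigns.of_capture`).

The exception is `λx.Vx → V`. Reduction is sound, but expansion loses atomic types, since an
abstraction has only arrow types. Without atomic types this obstruction vanishes and expansion
preserves the judgement exactly. For arbitrary atoms, a typing of the reduct is therefore pushed by
type substitution to the system with no atoms, expanded there, and carried back. This is why the
environments and the type may change in the second claim. -/

namespace CCV

open _root_.CCV.Expr

/-! ### Subtyping: inversion, reflexivity and transitivity -/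

section Subtyping

variable {A : Type*}

/-- The premises of the subtype rule that relates two raw types. -/
def RawLe (R R' : RawTy A) : Prop :=
  (∃ a, R = .atom a ∧ R' = .atom a) ∨
    ∃ S T S' T', R = .arrow S T ∧ R' = .arrow S' T' ∧ Subtype [S'] [S] ∧ Subtype T T'

theorem RawLe.subtype {R R' : RawTy A} (h : RawLe R R') : Subtype [[R]] [[R']] := by
  rcases h with ⟨a, rfl, rfl⟩ | ⟨S, T, S', T', rfl, rfl, hS, hT⟩
  · exact .atom a
  · exact .arrow hS hT

/-- Transitivity is not among the generating rules, so every rule preserves this pattern, and a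
plain induction inverts the whole relation at once. -/
theorem Subtype.exists_rawLe {T T' : Ty A} (h : Subtype T T') :
    ∀ S ∈ T, ∃ S' ∈ T', ∀ R' ∈ S', ∃ R ∈ S, RawLe R R' := by
  induction h with
  | atom a => simp [RawLe]
  | @arrow S S' T T' hS hT _ _ =>
    simp only [List.mem_singleton, forall_eq, exists_eq_left]
    exact Or.inr ⟨S, T, S', T', rfl, rfl, hS, hT⟩
  | interL hp _ ih =>
    simp only [List.mem_singleton, forall_eq, exists_eq_left] at ih ⊢
    intro R' hR'
    obtain ⟨R, hR, h⟩ := ih R' hR'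
    exact ⟨R, hp.subset hR, h⟩
  | interR Ss hp _ ih =>
    simp only [List.mem_singleton, forall_eq, exists_eq_left] at ih ⊢
    intro R' hR'
    obtain ⟨S', hS', hR'⟩ := List.mem_flatten.1 (hp.subset hR')
    exact ih S' hS' R' hR'
  | unionR hp _ ih =>
    intro S hS
    obtain ⟨S', hS', h⟩ := ih S hS
    exact ⟨S', hp.subset hS', h⟩
  | unionL Ts hp _ ih =>
    intro S hS
    obtain ⟨T, hT, hS⟩ := List.mem_flatten.1 (hp.subset hS)
    exact ih T hT S hS

theorem Subtype.sub_of_forall {S S' : SubTy A}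
    (h : ∀ R' ∈ S', ∃ R ∈ S, Subtype [[R]] [[R']]) : Subtype [S] [S'] := by
  refine .interR (S'.map fun R => [R]) ?_ ?_
  · rw [← List.flatMap_def, List.flatMap_singleton']
  · simp only [List.mem_map, forall_exists_index, and_imp, forall_apply_eq_imp_iff₂]
    intro R' hR'
    obtain ⟨R, hR, h⟩ := h R' hR'
    exact .interL (List.singleton_subperm_iff.2 hR) h

theorem Subtype.of_forall {T T' : Ty A}
    (h : ∀ S ∈ T, ∃ S' ∈ T', Subtype [S] [S']) : Subtype T T' := by
  refine .unionL (T.map fun S => [S]) ?_ ?_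
  · rw [← List.flatMap_def, List.flatMap_singleton']
  · simp only [List.mem_map, forall_exists_index, and_imp, forall_apply_eq_imp_iff₂]
    intro S hS
    obtain ⟨S', hS', h⟩ := h S hS
    exact .unionR (List.singleton_subperm_iff.2 hS') h

theorem subtype_raw_iff {R R' : RawTy A} : Subtype [[R]] [[R']] ↔ RawLe R R' :=
  ⟨fun h => by simpa using h.exists_rawLe, RawLe.subtype⟩

theorem subtype_sub_iff {S S' : SubTy A} :
    Subtype [S] [S'] ↔ ∀ R' ∈ S', ∃ R ∈ S, Subtype [[R]] [[R']] :=
  ⟨fun h => by simpa [subtype_raw_iff] using h.exists_rawLe, Subtype.sub_of_forall⟩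

theorem subtype_iff {T T' : Ty A} :
    Subtype T T' ↔ ∀ S ∈ T, ∃ S' ∈ T', Subtype [S] [S'] :=
  ⟨fun h S hS => by
    obtain ⟨S', hS', h⟩ := h.exists_rawLe S hS
    exact ⟨S', hS', .sub_of_forall fun R' hR' =>
      (h R' hR').imp fun R hR => ⟨hR.1, hR.2.subtype⟩⟩, Subtype.of_forall⟩

theorem sub_subtype_iff {S : SubTy A} {T : Ty A} :
    Subtype [S] T ↔ ∃ S' ∈ T, Subtype [S] [S'] := by
  rw [subtype_iff]; simp

theorem subtype_raw_refl (R : RawTy A) : Subtype [[R]] [[R]] := by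
  match R with
  | .atom a => exact .atom a
  | .arrow S T =>
    refine .arrow (.sub_of_forall fun R hR => ⟨R, hR, subtype_raw_refl R⟩)
      (.of_forall fun U hU => ⟨U, hU, .sub_of_forall fun R hR => ⟨R, hR, subtype_raw_refl R⟩⟩)
termination_by sizeOf R
decreasing_by
  · have := List.sizeOf_lt_of_mem hR
    simp; omega
  · have := List.sizeOf_lt_of_mem hR
    have := List.sizeOf_lt_of_mem hU
    simp; omega

theorem Subtype.sub_refl (S : SubTy A) : Subtype [S] [S] :=
  .sub_of_forall fun R hR => ⟨R, hR, subtype_raw_refl R⟩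

theorem Subtype.refl (T : Ty A) : Subtype T T :=
  .of_forall fun S hS => ⟨S, hS, .sub_refl S⟩

/-- The induction is on the size of the middle type: contravariance in the domain of an arrow
exchanges the outer types but leaves the middle one in place. -/
theorem subtype_raw_trans (R₂ : RawTy A) {R₁ R₃ : RawTy A} (h : Subtype [[R₁]] [[R₂]])
    (h' : Subtype [[R₂]] [[R₃]]) : Subtype [[R₁]] [[R₃]] := by
  rcases subtype_raw_iff.1 h with ⟨a, rfl, rfl⟩ | ⟨S₁, T₁, S₂, T₂, rfl, rfl, hS, hT⟩
  · exact h'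
  rcases subtype_raw_iff.1 h' with ⟨a, h, -⟩ | ⟨_, _, S₃, T₃, h, rfl, hS', hT'⟩
  · cases h
  cases h
  refine .arrow (.sub_of_forall fun R₁ hR₁ => ?_) (.of_forall fun U₁ hU₁ => ?_)
  · obtain ⟨R₂, hR₂, h₁⟩ := subtype_sub_iff.1 hS R₁ hR₁
    obtain ⟨R₃, hR₃, h₂⟩ := subtype_sub_iff.1 hS' R₂ hR₂
    exact ⟨R₃, hR₃, subtype_raw_trans R₂ h₂ h₁⟩
  · obtain ⟨U₂, hU₂, h₁⟩ := subtype_iff.1 hT U₁ hU₁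
    obtain ⟨U₃, hU₃, h₂⟩ := subtype_iff.1 hT' U₂ hU₂
    refine ⟨U₃, hU₃, .sub_of_forall fun R₃ hR₃ => ?_⟩
    obtain ⟨R₂, hR₂, h₃⟩ := subtype_sub_iff.1 h₂ R₃ hR₃
    obtain ⟨R₁, hR₁, h₄⟩ := subtype_sub_iff.1 h₁ R₂ hR₂
    exact ⟨R₁, hR₁, subtype_raw_trans R₂ h₄ h₃⟩
termination_by sizeOf R₂
decreasing_by
  · have := List.sizeOf_lt_of_mem hR₂
    subst_vars; simp; omega
  · have := List.sizeOf_lt_of_mem hR₂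
    have := List.sizeOf_lt_of_mem hU₂
    subst_vars; simp; omega

theorem Subtype.sub_trans {S₁ S₂ S₃ : SubTy A} (h : Subtype [S₁] [S₂])
    (h' : Subtype [S₂] [S₃]) : Subtype [S₁] [S₃] := by
  refine .sub_of_forall fun R₃ hR₃ => ?_
  obtain ⟨R₂, hR₂, h₂⟩ := subtype_sub_iff.1 h' R₃ hR₃
  obtain ⟨R₁, hR₁, h₁⟩ := subtype_sub_iff.1 h R₂ hR₂
  exact ⟨R₁, hR₁, subtype_raw_trans R₂ h₁ h₂⟩

theorem Subtype.trans {T₁ T₂ T₃ : Ty A} (h : Subtype T₁ T₂) (h' : Subtype T₂ T₃) :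
    Subtype T₁ T₃ := by
  refine .of_forall fun S₁ hS₁ => ?_
  obtain ⟨S₂, hS₂, h₁⟩ := subtype_iff.1 h S₁ hS₁
  obtain ⟨S₃, hS₃, h₂⟩ := subtype_iff.1 h' S₂ hS₂
  exact ⟨S₃, hS₃, h₁.sub_trans h₂⟩

theorem Subtype.sub_of_subset {S S' : SubTy A} (h : S' ⊆ S) : Subtype [S] [S'] :=
  .sub_of_forall fun R hR => ⟨R, h hR, subtype_raw_refl R⟩

theorem Subtype.sub_of_mem {R : RawTy A} {S : SubTy A} (h : R ∈ S) : Subtype [S] [[R]] :=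
  .sub_of_forall fun _ hR' => ⟨R, h, List.mem_singleton.1 hR' ▸ subtype_raw_refl R⟩

theorem Subtype.of_mem {S : SubTy A} {T : Ty A} (h : S ∈ T) : Subtype [S] T :=
  sub_subtype_iff.2 ⟨S, h, .sub_refl S⟩

theorem Subtype.of_subset {T T' : Ty A} (h : T ⊆ T') : Subtype T T' :=
  .of_forall fun S hS => ⟨S, h hS, .sub_refl S⟩

/-- The order on what an expression is assigned. -/
def JTy.Le : {s : Kind} → JTy A s → JTy A s → Prop
  | _, .ty T, .ty T' => Subtype T T'
  | _, .bot, .bot => True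

theorem JTy.Le.refl {s : Kind} (τ : JTy A s) : τ.Le τ := by
  cases τ
  · exact Subtype.refl _
  · trivial

end Subtyping

/-! ### Syntax-directed type assignment -/

/-- The environment that gives `a` to the variable `0` and extends `f`. -/
def envCons {α : Type*} (a : α) (f : ℕ → α) : ℕ → α
  | 0 => a
  | n + 1 => f n

theorem envCons_comp_liftRen {α : Type*} (a : α) (f : ℕ → α) (ξ : ℕ → ℕ) :
    envCons a f ∘ liftRen ξ = envCons a (f ∘ ξ) := by
  funext n; cases n <;> rfl

theorem envCons_comp_succ {α : Type*} (a : α) (f : ℕ → α) : envCons a f ∘ Nat.succ = f := rfl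

theorem envCons_getD {α : Type*} (a d : α) (l : List α) :
    (fun i => (a :: l).getD i d) = envCons a (fun i => l.getD i d) := by
  funext n; cases n <;> rfl

theorem map_envCons {α β : Type*} (g : α → β) (a : α) (f : ℕ → α) :
    (fun i => g (envCons a f i)) = envCons (g a) (fun i => g (f i)) := by
  funext n; cases n <;> rfl

theorem envCons_rel {α : Type*} {r : α → α → Prop} {a b : α} {f g : ℕ → α} (h : r a b)
    (h' : ∀ i, r (f i) (g i)) (i : ℕ) : r (envCons a f i) (envCons b g i) := by
  cases i
  · exact h
  · exact h' _

/-- Type assignment by recursion on the expression, with the inheritance rule built in.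
Environments are functions on variables. -/
def Assigns {A : Type*} : {s : Kind} → Expr s → (ℕ → SubTy A) → (ℕ → Ty A) → JTy A s → Prop
  | _, .var i, Γ, _, .ty T => Subtype [Γ i] T
  | _, .lam M, Γ, Δ, .ty T => ∃ S ∈ T, ∀ R ∈ S, ∃ S₁ T₁,
      R = .arrow S₁ T₁ ∧ Assigns M (envCons S₁ Γ) Δ (.ty T₁)
  | _, .app M N, Γ, Δ, .ty T => ∃ T₀, Assigns M Γ Δ (.ty T₀) ∧ ∀ S ∈ T₀, ∃ T₁,
      Assigns N Γ Δ (.ty T₁) ∧ ∀ S₁ ∈ T₁, Subtype [S] [[.arrow S₁ T]]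
  | _, .letIn L N, Γ, Δ, τ => ∃ T₀, Assigns N Γ Δ (.ty T₀) ∧ ∀ S ∈ T₀,
      Assigns L (envCons S Γ) Δ τ
  | _, .mu J, Γ, Δ, .ty T => Assigns J Γ (envCons T Δ) .bot
  | _, .jmp k M, Γ, Δ, .bot => Assigns M Γ Δ (.ty (Δ k))

section Assigns

variable {A : Type*} {s : Kind}

/-- This makes inheritance admissible. Continuation environments are covariant because a jump to `k`
delivers a term of type `Δ k`, so enlarging `Δ k` weakens the demand. -/
theorem Assigns.mono {M : Expr s} {Γ Γ' : ℕ → SubTy A} {Δ Δ' : ℕ → Ty A} {τ τ' : JTy A s}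
    (h : Assigns M Γ Δ τ) (hΓ : ∀ i, Subtype [Γ' i] [Γ i]) (hΔ : ∀ k, Subtype (Δ k) (Δ' k))
    (hτ : τ.Le τ') : Assigns M Γ' Δ' τ' := by
  induction M generalizing Γ Γ' Δ Δ' with
  | var i =>
    cases τ; cases τ'
    exact ((hΓ i).trans h).trans hτ
  | lam M ih =>
    cases τ; cases τ'
    obtain ⟨S, hS, h⟩ := h
    obtain ⟨S', hS', hle⟩ := subtype_iff.1 hτ S hS
    refine ⟨S', hS', fun R' hR' => ?_⟩
    obtain ⟨R, hR, hle⟩ := subtype_sub_iff.1 hle R' hR'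
    obtain ⟨S₁, T₁, rfl, h⟩ := h R hR
    rcases subtype_raw_iff.1 hle with ⟨a, h, -⟩ | ⟨_, _, S₂, T₂, h', rfl, h₁, h₂⟩
    · cases h
    cases h'
    exact ⟨S₂, T₂, rfl, ih h (envCons_rel (r := fun S S' => Subtype [S] [S']) h₁ hΓ) hΔ h₂⟩
  | app M N ihM ihN =>
    cases τ; cases τ'
    obtain ⟨T₀, hM, h⟩ := h
    refine ⟨T₀, ihM hM hΓ hΔ (.refl _), fun S hS => ?_⟩
    obtain ⟨T₁, hN, h⟩ := h S hS
    exact ⟨T₁, ihN hN hΓ hΔ (.refl _),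
      fun S₁ hS₁ => (h S₁ hS₁).trans (.arrow (.refl _) hτ)⟩
  | letIn L N ihL ihN =>
    obtain ⟨T₀, hN, h⟩ := h
    exact ⟨T₀, ihN hN hΓ hΔ (.refl _), fun S hS => ihL (h S hS)
      (envCons_rel (r := fun S S' => Subtype [S] [S']) (.refl _) hΓ) hΔ hτ⟩
  | mu J ih =>
    cases τ; cases τ'
    exact ih h hΓ (envCons_rel hτ hΔ) trivial
  | jmp k M ih =>
    cases τ; cases τ'
    exact ih h hΓ hΔ (hΔ k)

theorem Assigns.mono_env {M : Expr s} {Γ Γ' : ℕ → SubTy A} {Δ : ℕ → Ty A} {τ : JTy A s}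
    (h : Assigns M Γ Δ τ) (hΓ : ∀ i, Subtype [Γ' i] [Γ i]) : Assigns M Γ' Δ τ :=
  h.mono hΓ (fun _ => .refl _) (.refl _)

theorem Assigns.mono_contEnv {M : Expr s} {Γ : ℕ → SubTy A} {Δ Δ' : ℕ → Ty A} {τ : JTy A s}
    (h : Assigns M Γ Δ τ) (hΔ : ∀ k, Subtype (Δ k) (Δ' k)) : Assigns M Γ Δ' τ :=
  h.mono (fun _ => .refl _) hΔ (.refl _)

theorem Assigns.mono_ty {M : Expr .term} {Γ : ℕ → SubTy A} {Δ : ℕ → Ty A} {T T' : Ty A}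
    (h : Assigns M Γ Δ (.ty T)) (hT : Subtype T T') : Assigns M Γ Δ (.ty T') :=
  h.mono (fun _ => .refl _) (fun _ => .refl _) hT

theorem assigns_rename {M : Expr s} {Γ : ℕ → SubTy A} {Δ : ℕ → Ty A} {τ : JTy A s}
    {ξ : ℕ → ℕ} : Assigns (rename ξ M) Γ Δ τ ↔ Assigns M (Γ ∘ ξ) Δ τ := by
  induction M generalizing Γ Δ ξ with
  | jmp k M ih => cases τ; simp only [rename, Assigns, ih]
  | letIn L N ihL ihN => simp only [rename, Assigns, ihL, ihN, envCons_comp_liftRen]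
  | var i => cases τ; rfl
  | _ => cases τ; simp only [rename, Assigns, envCons_comp_liftRen, *]

theorem assigns_renameK {M : Expr s} {Γ : ℕ → SubTy A} {Δ : ℕ → Ty A} {τ : JTy A s}
    {ζ : ℕ → ℕ} : Assigns (renameK ζ M) Γ Δ τ ↔ Assigns M Γ (Δ ∘ ζ) τ := by
  induction M generalizing Γ Δ ζ with
  | jmp k M ih => cases τ; simp only [renameK, Assigns, ih, Function.comp]
  | letIn L N ihL ihN => simp only [renameK, Assigns, ihL, ihN]
  | var i => cases τ; rfl
  | _ => cases τ; simp only [renameK, Assigns, envCons_comp_liftRen, *]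

theorem assigns_shift {M : Expr s} {Γ : ℕ → SubTy A} {Δ : ℕ → Ty A} {τ : JTy A s}
    {S : SubTy A} : Assigns (shift M) (envCons S Γ) Δ τ ↔ Assigns M Γ Δ τ :=
  assigns_rename

theorem assigns_shiftK {M : Expr s} {Γ : ℕ → SubTy A} {Δ : ℕ → Ty A} {τ : JTy A s}
    {T : Ty A} : Assigns (shiftK M) Γ (envCons T Δ) τ ↔ Assigns M Γ Δ τ :=
  assigns_renameK

/-! ### Agreement with the typing rules -/

theorem Typing.assigns {M : Expr s} {Γ : List (SubTy A)} {Δ : List (Ty A)} {τ : JTy A s}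
    (h : Typing Γ M τ Δ) :
    Assigns M (fun i => Γ.getD i []) (fun k => Δ.getD k []) τ := by
  induction h with
  | var Γ Δ i => exact Subtype.refl _
  | lam P _ ih =>
    refine ⟨_, List.mem_singleton_self _, ?_⟩
    simp only [List.mem_map, forall_exists_index, and_imp, forall_apply_eq_imp_iff₂]
    intro p hp
    exact ⟨_, _, rfl, envCons_getD p.1 [] _ ▸ ih p hp⟩
  | app U _ _ ihM ihN =>
    refine ⟨_, ihM, ?_⟩
    simp only [List.mem_map, forall_exists_index, and_imp, forall_apply_eq_imp_iff₂]
    exact fun T₁ hT₁ => ⟨T₁, ihN T₁ hT₁, fun S₁ hS₁ => .sub_of_mem (List.mem_map_of_mem hS₁)⟩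
  | letIn Ss _ _ ihL ihN =>
    exact ⟨Ss, ihN, fun S hS => envCons_getD S [] _ ▸ ihL S hS⟩
  | @mu Γ Δ J T _ ih => simpa only [Assigns, envCons_getD] using ih
  | jmp k _ ih => exact ih
  | inherit _ hT ih => exact ih.mono_ty hT

/-- Explicit inheritance is needed only at variables, at abstractions and at the function part of an
application. -/
theorem Assigns.typing {M : Expr s} {Γ : List (SubTy A)} {Δ : List (Ty A)} {τ : JTy A s}
    (h : Assigns M (fun i => Γ.getD i []) (fun k => Δ.getD k []) τ) : Typing Γ M τ Δ := by
  induction M generalizing Γ Δ with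
  | var i =>
    cases τ
    exact .inherit (.var Γ Δ i) h
  | lam M ih =>
    cases τ
    obtain ⟨S, hS, h⟩ := h
    choose! f g hfg hM using h
    refine .inherit (.lam (S.map fun R => (f R, g R)) ?_) (sub_subtype_iff.2 ⟨S, hS, ?_⟩)
    · simp only [List.mem_map, forall_exists_index, and_imp, forall_apply_eq_imp_iff₂]
      exact fun R hR => ih (by rw [envCons_getD]; exact hM R hR)
    · refine .sub_of_subset fun R hR => ?_
      simp only [List.map_map, List.mem_map, Function.comp]
      exact ⟨R, hR, (hfg R hR).symm⟩
  | app M N ihM ihN =>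
    cases τ
    obtain ⟨T₀, hM, h⟩ := h
    choose! V hN hV using h
    -- Each member `S` of `T₀` lies below the intersection of the arrows `S₁ → T` with `S₁` in `V
    -- S`, so `T₀` can be enlarged to the shape that the rule requires.
    refine .app (T₀.map V) (.inherit (ihM hM) (.of_forall fun S hS => ?_)) ?_
    · refine ⟨_, List.mem_map_of_mem (List.mem_map_of_mem hS), .sub_of_forall ?_⟩
      simp only [List.mem_map, forall_exists_index, and_imp, forall_apply_eq_imp_iff₂]
      exact fun S₁ hS₁ => subtype_sub_iff.1 (hV S hS S₁ hS₁) _ (List.mem_singleton_self _)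
    · simp only [List.mem_map, forall_exists_index, and_imp, forall_apply_eq_imp_iff₂]
      exact fun S hS => ihN (hN S hS)
  | letIn L N ihL ihN =>
    obtain ⟨T₀, hN, h⟩ := h
    exact .letIn T₀ (fun S hS => ihL (by rw [envCons_getD]; exact h S hS)) (ihN hN)
  | mu J ih =>
    cases τ
    exact .mu (ih (by rw [envCons_getD]; exact h))
  | jmp k M ih =>
    cases τ
    exact .jmp k (ih h)

/-! ### Values -/

/-- Unlike a `μ`-abstraction, which may return several times at different types, a value makes a
single choice in a union. -/
theorem Assigns.exists_mem_of_isValue {V : Expr .term} (hV : IsValue V) {Γ : ℕ → SubTy A}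
    {Δ : ℕ → Ty A} {T : Ty A} (h : Assigns V Γ Δ (.ty T)) :
    ∃ S ∈ T, Assigns V Γ Δ (.ty [S]) := by
  cases V with
  | var i => exact sub_subtype_iff.1 h
  | lam M =>
    obtain ⟨S, hS, h⟩ := h
    exact ⟨S, hS, S, List.mem_singleton_self _, h⟩
  | _ => exact hV.elim

/-- The empty intersection is included: every value has type `ω`. -/
theorem assigns_inter_of_isValue {V : Expr .term} (hV : IsValue V) {Γ : ℕ → SubTy A}
    {Δ : ℕ → Ty A} {S : SubTy A} (h : ∀ R ∈ S, Assigns V Γ Δ (.ty [[R]])) :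
    Assigns V Γ Δ (.ty [S]) := by
  cases V with
  | var i =>
    refine Subtype.sub_of_forall fun R hR => ?_
    simpa using subtype_sub_iff.1 (h R hR)
  | lam M =>
    refine ⟨S, List.mem_singleton_self _, fun R hR => ?_⟩
    simpa [Assigns] using h R hR
  | _ => exact hV.elim

theorem isValue_rename {V : Expr s} (hV : IsValue V) (ξ : ℕ → ℕ) : IsValue (rename ξ V) := by
  cases V <;> trivial

theorem isValue_renameK {V : Expr s} (hV : IsValue V) (ζ : ℕ → ℕ) : IsValue (renameK ζ V) := by
  cases V <;> trivial

/-! ### Substitution -/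

theorem Assigns.subst {M : Expr s} {Γ Γ' : ℕ → SubTy A} {Δ : ℕ → Ty A} {τ : JTy A s}
    (h : Assigns M Γ Δ τ) {σ : ℕ → Expr .term} (hσ : ∀ i, Assigns (σ i) Γ' Δ (.ty [Γ i])) :
    Assigns (subst σ M) Γ' Δ τ := by
  have lift : ∀ (Γ Γ' : ℕ → SubTy A) (Δ : ℕ → Ty A) (σ : ℕ → Expr .term) (S : SubTy A),
      (∀ i, Assigns (σ i) Γ' Δ (.ty [Γ i])) →
      ∀ i, Assigns (liftSubst σ i) (envCons S Γ') Δ (.ty [envCons S Γ i]) := by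
    intro Γ Γ' Δ σ S hσ i
    cases i
    · exact Subtype.refl _
    · exact assigns_shift.2 (hσ _)
  induction M generalizing Γ Γ' Δ σ with
  | var i =>
    cases τ
    exact (hσ i).mono_ty h
  | lam M ih =>
    cases τ
    obtain ⟨S, hS, h⟩ := h
    refine ⟨S, hS, fun R hR => ?_⟩
    obtain ⟨S₁, T₁, rfl, h⟩ := h R hR
    exact ⟨S₁, T₁, rfl, ih h (lift _ _ _ _ _ hσ)⟩
  | app M N ihM ihN =>
    cases τ
    obtain ⟨T₀, hM, h⟩ := h
    refine ⟨T₀, ihM hM hσ, fun S hS => ?_⟩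
    obtain ⟨T₁, hN, h⟩ := h S hS
    exact ⟨T₁, ihN hN hσ, h⟩
  | letIn L N ihL ihN =>
    obtain ⟨T₀, hN, h⟩ := h
    exact ⟨T₀, ihN hN hσ, fun S hS => ihL (h S hS) (lift _ _ _ _ _ hσ)⟩
  | mu J ih =>
    cases τ
    exact ih (τ := .bot) h fun i => assigns_shiftK.2 (hσ i)
  | jmp k M ih =>
    cases τ
    exact ih (τ := .ty _) h hσ

/-- In a nonempty set `P` directed by `r`, finitely many conditions that are stable under `r` and
satisfiable in `P` have a common witness. -/
theorem exists_forall_mem_of_directed {X ι : Type*} {P : X → Prop} {r : X → X → Prop}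
    (hne : ∃ x, P x) (hdir : ∀ x y, P x → P y → ∃ z, P z ∧ r x z ∧ r y z) (l : List ι)
    {Q : ι → X → Prop} (hQ : ∀ a x y, r x y → Q a x → Q a y)
    (h : ∀ a ∈ l, ∃ x, P x ∧ Q a x) : ∃ x, P x ∧ ∀ a ∈ l, Q a x := by
  induction l with
  | nil => simpa using hne
  | cons a l ih =>
    obtain ⟨x, hx, hax⟩ := h a List.mem_cons_self
    obtain ⟨y, hy, hly⟩ := ih fun b hb => h b (List.mem_cons_of_mem _ hb)
    obtain ⟨z, hz, hxz, hyz⟩ := hdir x y hx hy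
    refine ⟨z, hz, fun b hb => ?_⟩
    rcases List.mem_cons.1 hb with rfl | hb
    · exact hQ _ _ _ hxz hax
    · exact hQ _ _ _ hyz (hly b hb)

/-- `σ` substitutes for each variable a value of the type given by `Γ`. -/
def SubstAssigns (σ : ℕ → Expr .term) (Γ' : ℕ → SubTy A) (Δ : ℕ → Ty A) (Γ : ℕ → SubTy A) :
    Prop := ∀ i, Assigns (σ i) Γ' Δ (.ty [Γ i])

/-- Pointwise subtyping of environments, the larger environment first. -/
def EnvGe (Γ Γ' : ℕ → SubTy A) : Prop := ∀ i, Subtype [Γ' i] [Γ i]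

theorem SubstAssigns.directed {σ : ℕ → Expr .term} (hσ : ∀ i, IsValue (σ i)) {Γ' : ℕ → SubTy A}
    {Δ : ℕ → Ty A} (Γ₁ Γ₂ : ℕ → SubTy A) (h₁ : SubstAssigns σ Γ' Δ Γ₁)
    (h₂ : SubstAssigns σ Γ' Δ Γ₂) :
    ∃ Γ, SubstAssigns σ Γ' Δ Γ ∧ EnvGe Γ₁ Γ ∧ EnvGe Γ₂ Γ := by
  refine ⟨fun i => Γ₁ i ++ Γ₂ i, fun i => assigns_inter_of_isValue (hσ i) fun R hR => ?_,
    fun i => .sub_of_subset (List.subset_append_left _ _),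
    fun i => .sub_of_subset (List.subset_append_right _ _)⟩
  rcases List.mem_append.1 hR with hR | hR
  · exact (h₁ i).mono_ty (.sub_of_mem hR)
  · exact (h₂ i).mono_ty (.sub_of_mem hR)

theorem SubstAssigns.nonempty {σ : ℕ → Expr .term} (hσ : ∀ i, IsValue (σ i))
    {Γ' : ℕ → SubTy A} {Δ : ℕ → Ty A} : ∃ Γ, SubstAssigns σ Γ' Δ Γ :=
  ⟨fun _ => [], fun i => assigns_inter_of_isValue (hσ i) (by simp)⟩

/-- Under a binder the induction hypothesis returns some type for the bound variable. That variable
is substituted by itself, so its declared type `S` is smaller and may be restored. -/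
theorem SubstAssigns.of_lift {σ : ℕ → Expr .term} {Γ' Γ : ℕ → SubTy A} {Δ : ℕ → Ty A}
    {S : SubTy A} (h : SubstAssigns (liftSubst σ) (envCons S Γ') Δ Γ) :
    SubstAssigns σ Γ' Δ (Γ ∘ Nat.succ) ∧ EnvGe Γ (envCons S (Γ ∘ Nat.succ)) := by
  refine ⟨fun i => assigns_shift.1 (h (i + 1)), fun i => ?_⟩
  cases i
  · exact h 0
  · exact .refl _

theorem isValue_liftSubst {σ : ℕ → Expr .term} (hσ : ∀ i, IsValue (σ i)) (i : ℕ) :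
    IsValue (liftSubst σ i) := by
  cases i
  · trivial
  · exact isValue_rename (hσ _) _

/-- Different premises may require different types of the same substituted value. There are finitely
many, so their intersection, available by directedness, serves them all. -/
theorem Assigns.of_subst {M : Expr s} {Γ' : ℕ → SubTy A} {Δ : ℕ → Ty A} {τ : JTy A s}
    {σ : ℕ → Expr .term} (hσ : ∀ i, IsValue (σ i)) (h : Assigns (Expr.subst σ M) Γ' Δ τ) :
    ∃ Γ, SubstAssigns σ Γ' Δ Γ ∧ Assigns M Γ Δ τ := by
  induction M generalizing Γ' Δ σ with
  | var i =>
    cases τ with | ty T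
    obtain ⟨S, hS, h⟩ := Assigns.exists_mem_of_isValue (hσ i) h
    -- Only the variable that occurs needs a type; all others get `ω`.
    refine ⟨fun j => if j = i then S else [], fun j => ?_, ?_⟩
    · by_cases hj : j = i
      · subst hj; simpa using h
      · simpa [hj] using assigns_inter_of_isValue (hσ j) (S := []) (by simp)
    · exact sub_subtype_iff.2 ⟨S, hS, by simpa using Subtype.refl _⟩
  | lam M ih =>
    cases τ with | ty T
    obtain ⟨S, hS, h⟩ := h
    obtain ⟨Γ, hΓ, h⟩ := exists_forall_mem_of_directed (r := EnvGe)
      (Q := fun R Γ => ∃ S₁ T₁, R = .arrow S₁ T₁ ∧ Assigns M (envCons S₁ Γ) Δ (.ty T₁))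
      (SubstAssigns.nonempty hσ) (SubstAssigns.directed hσ) S
      (by
        rintro R Γ₁ Γ₂ hle ⟨S₁, T₁, rfl, h⟩
        exact ⟨S₁, T₁, rfl, h.mono_env (envCons_rel (r := fun S S' => Subtype [S] [S'])
          (.refl _) hle)⟩)
      (by
        intro R hR
        obtain ⟨S₁, T₁, rfl, h⟩ := h R hR
        obtain ⟨Γ, hΓ, h⟩ := ih (isValue_liftSubst hσ) h
        exact ⟨_, hΓ.of_lift.1, S₁, T₁, rfl, h.mono_env hΓ.of_lift.2⟩)
    exact ⟨Γ, hΓ, S, hS, h⟩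
  | app M N ihM ihN =>
    cases τ with | ty T
    obtain ⟨T₀, hM, h⟩ := h
    obtain ⟨Γ₁, hΓ₁, hM⟩ := ihM hσ hM
    obtain ⟨Γ₂, hΓ₂, h⟩ := exists_forall_mem_of_directed (r := EnvGe)
      (Q := fun S Γ => ∃ T₁, Assigns N Γ Δ (.ty T₁) ∧ ∀ S₁ ∈ T₁, Subtype [S] [[.arrow S₁ T]])
      (SubstAssigns.nonempty hσ) (SubstAssigns.directed hσ) T₀
      (by
        rintro S Γ₁ Γ₂ hle ⟨T₁, hN, h⟩
        exact ⟨T₁, hN.mono_env hle, h⟩)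
      (by
        intro S hS
        obtain ⟨T₁, hN, h⟩ := h S hS
        obtain ⟨Γ, hΓ, hN⟩ := ihN hσ hN
        exact ⟨Γ, hΓ, T₁, hN, h⟩)
    obtain ⟨Γ, hΓ, hle₁, hle₂⟩ := SubstAssigns.directed hσ _ _ hΓ₁ hΓ₂
    refine ⟨Γ, hΓ, T₀, hM.mono_env hle₁, fun S hS => ?_⟩
    obtain ⟨T₁, hN, h⟩ := h S hS
    exact ⟨T₁, hN.mono_env hle₂, h⟩
  | letIn L N ihL ihN =>
    obtain ⟨T₀, hN, h⟩ := h
    obtain ⟨Γ₁, hΓ₁, hN⟩ := ihN hσ hN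
    obtain ⟨Γ₂, hΓ₂, h⟩ := exists_forall_mem_of_directed (r := EnvGe)
      (Q := fun S Γ => Assigns L (envCons S Γ) Δ τ)
      (SubstAssigns.nonempty hσ) (SubstAssigns.directed hσ) T₀
      (fun S Γ₁ Γ₂ hle h => h.mono_env (envCons_rel (r := fun S S' => Subtype [S] [S'])
          (.refl _) hle))
      (by
        intro S hS
        obtain ⟨Γ, hΓ, h⟩ := ihL (isValue_liftSubst hσ) (h S hS)
        exact ⟨_, hΓ.of_lift.1, h.mono_env hΓ.of_lift.2⟩)
    obtain ⟨Γ, hΓ, hle₁, hle₂⟩ := SubstAssigns.directed hσ _ _ hΓ₁ hΓ₂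
    exact ⟨Γ, hΓ, T₀, hN.mono_env hle₁, fun S hS => (h S hS).mono_env
      (envCons_rel (r := fun S S' => Subtype [S] [S']) (.refl _) hle₂)⟩
  | mu J ih =>
    cases τ with | ty T
    obtain ⟨Γ, hΓ, h⟩ := ih (τ := .bot) (fun i => isValue_renameK (hσ i) _) h
    exact ⟨Γ, fun i => assigns_shiftK.1 (hΓ i), h⟩
  | jmp k M ih =>
    cases τ
    exact ih (τ := .ty _) hσ h

theorem assigns_letIn_iff_of_isValue {M : Expr s} {V : Expr .term} (hV : IsValue V)
    {Γ : ℕ → SubTy A} {Δ : ℕ → Ty A} {τ : JTy A s} :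
    Assigns (letIn M V) Γ Δ τ ↔
      ∃ S, Assigns V Γ Δ (.ty [S]) ∧ Assigns M (envCons S Γ) Δ τ := by
  constructor
  · rintro ⟨T₀, h, hM⟩
    obtain ⟨S, hS, h⟩ := h.exists_mem_of_isValue hV
    exact ⟨S, h, hM S hS⟩
  · rintro ⟨S, h, hM⟩
    exact ⟨[S], h, by simpa using hM⟩

theorem assigns_inst_iff {M : Expr s} {V : Expr .term} (hV : IsValue V)
    {Γ : ℕ → SubTy A} {Δ : ℕ → Ty A} {τ : JTy A s} :
    Assigns (inst V M) Γ Δ τ ↔ Assigns (letIn M V) Γ Δ τ := by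
  rw [assigns_letIn_iff_of_isValue hV]
  constructor
  · intro h
    obtain ⟨Γ', hΓ', h⟩ := h.of_subst (by rintro (_ | i) <;> first | exact hV | trivial)
    refine ⟨Γ' 0, hΓ' 0, h.mono_env fun i => ?_⟩
    cases i with
    | zero => exact .refl _
    | succ i => exact hΓ' (i + 1)
  · rintro ⟨S, h, hM⟩
    refine hM.subst fun i => ?_
    cases i with
    | zero => exact h
    | succ i => exact Subtype.refl _

/-! ### Capture of the continuation -/

theorem envCons_update {α : Type*} (a b : α) (f : ℕ → α) (k : ℕ) :
    envCons a (Function.update f k b) = Function.update (envCons a f) (k + 1) b := by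
  funext n
  cases n with
  | zero => simp [envCons]
  | succ n => simp [envCons, Function.update_apply]

theorem assigns_weaken_under {M : Expr s} {Γ : ℕ → SubTy A} {Δ : ℕ → Ty A} {τ : JTy A s}
    {S S' : SubTy A} : Assigns (rename (liftRen Nat.succ) M) (envCons S (envCons S' Γ)) Δ τ ↔
      Assigns M (envCons S Γ) Δ τ := by
  rw [assigns_rename, envCons_comp_liftRen, envCons_comp_succ]

/-- At a jump to `k`, the argument of type `T₀` is fed to `M`, which handles each member of `T₀` and
returns at type `Δ k`; this is the let rule. -/
theorem Assigns.capture {J : Expr s} {k : ℕ} {T₀ : Ty A} {M : Expr .term} {Γ : ℕ → SubTy A}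
    {Δ : ℕ → Ty A} {τ : JTy A s} (h : Assigns J Γ (Function.update Δ k T₀) τ)
    (hM : ∀ S ∈ T₀, Assigns M (envCons S Γ) Δ (.ty (Δ k))) :
    Assigns (capture k M J) Γ Δ τ := by
  induction J generalizing Γ Δ M k with
  | var i => cases τ; exact h
  | lam N ih =>
    cases τ
    obtain ⟨S, hS, h⟩ := h
    refine ⟨S, hS, fun R hR => ?_⟩
    obtain ⟨S₁, T₁, rfl, h⟩ := h R hR
    exact ⟨S₁, T₁, rfl, ih h fun S hS => assigns_weaken_under.2 (hM S hS)⟩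
  | app N P ihN ihP =>
    cases τ
    obtain ⟨T₁, hN, h⟩ := h
    refine ⟨T₁, ihN hN hM, fun S hS => ?_⟩
    obtain ⟨T₂, hP, h⟩ := h S hS
    exact ⟨T₂, ihP hP hM, h⟩
  | letIn L N ihL ihN =>
    obtain ⟨T₁, hN, h⟩ := h
    exact ⟨T₁, ihN hN hM,
      fun S hS => ihL (h S hS) fun S hS => assigns_weaken_under.2 (hM S hS)⟩
  | mu J ih =>
    cases τ with | ty T
    refine ih (τ := .bot) (k := k + 1) (Δ := envCons T Δ) ?_ fun S hS =>
      assigns_shiftK.2 (hM S hS)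
    rw [← envCons_update]
    exact h
  | jmp l Q ih =>
    cases τ
    by_cases hl : l = k
    · subst hl
      simp only [Expr.capture, if_true]
      refine ⟨T₀, ih (τ := .ty _) ?_ hM, hM⟩
      simpa [Assigns] using h
    · simp only [Expr.capture, if_neg hl]
      refine ih (τ := .ty _) ?_ hM
      simpa [Assigns, hl] using h

theorem subtype_update_of_subset {T₀ T₁ : Ty A} (h : T₀ ⊆ T₁) (Δ : ℕ → Ty A) (k i : ℕ) :
    Subtype (Function.update Δ k T₀ i) (Function.update Δ k T₁ i) := by
  by_cases hi : i = k
  · subst hi; simpa using Subtype.of_subset h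
  · simpa [hi] using Subtype.refl _

/-- Dual to `Assigns.of_subst`: the admissible `T₀` are closed under finite unions, so one `T₀`
covers every jump to `k`. -/
theorem Assigns.of_capture {J : Expr s} {k : ℕ} {M : Expr .term} {Γ : ℕ → SubTy A}
    {Δ : ℕ → Ty A} {τ : JTy A s} (h : Assigns (Expr.capture k M J) Γ Δ τ) :
    ∃ T₀ : Ty A, (∀ S ∈ T₀, Assigns M (envCons S Γ) Δ (.ty (Δ k))) ∧
      Assigns J Γ (Function.update Δ k T₀) τ := by
  have dir : ∀ (M : Expr .term) (Γ : ℕ → SubTy A) (Δ : ℕ → Ty A) (k : ℕ) (T₁ T₂ : Ty A),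
      (∀ S ∈ T₁, Assigns M (envCons S Γ) Δ (.ty (Δ k))) →
      (∀ S ∈ T₂, Assigns M (envCons S Γ) Δ (.ty (Δ k))) →
      ∃ T₀ : Ty A, (∀ S ∈ T₀, Assigns M (envCons S Γ) Δ (.ty (Δ k))) ∧ T₁ ⊆ T₀ ∧ T₂ ⊆ T₀ := by
    intro M Γ Δ k T₁ T₂ h₁ h₂
    exact ⟨T₁ ++ T₂, fun S hS => (List.mem_append.1 hS).elim (h₁ S) (h₂ S),
      List.subset_append_left _ _, List.subset_append_right _ _⟩
  induction J generalizing Γ Δ M k with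
  | var i => cases τ; exact ⟨[], by simp, h⟩
  | lam N ih =>
    cases τ with | ty T
    obtain ⟨S, hS, h⟩ := h
    obtain ⟨T₀, hT₀, h⟩ := exists_forall_mem_of_directed (r := fun T₁ T₂ : Ty A => T₁ ⊆ T₂)
      (Q := fun R T₀ => ∃ S₁ T₁, R = .arrow S₁ T₁ ∧
        Assigns N (envCons S₁ Γ) (Function.update Δ k T₀) (.ty T₁))
      ⟨[], by simp⟩ (dir M Γ Δ k) S
      (by
        rintro R T₁ T₂ hle ⟨S₁, T₁, rfl, h⟩
        exact ⟨S₁, T₁, rfl, h.mono_contEnv (subtype_update_of_subset hle Δ k)⟩)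
      (by
        intro R hR
        obtain ⟨S₁, T₁, rfl, h⟩ := h R hR
        obtain ⟨T₀, hT₀, h⟩ := ih h
        exact ⟨T₀, fun S hS => assigns_weaken_under.1 (hT₀ S hS), S₁, T₁, rfl, h⟩)
    exact ⟨T₀, hT₀, S, hS, h⟩
  | app N P ihN ihP =>
    cases τ with | ty T
    obtain ⟨T₁, hN, h⟩ := h
    obtain ⟨T₂, hT₂, hN⟩ := ihN hN
    obtain ⟨T₃, hT₃, h⟩ := exists_forall_mem_of_directed (r := fun T₁ T₂ : Ty A => T₁ ⊆ T₂)
      (Q := fun S T₀ => ∃ T₁, Assigns P Γ (Function.update Δ k T₀) (.ty T₁) ∧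
        ∀ S₁ ∈ T₁, Subtype [S] [[.arrow S₁ T]])
      ⟨[], by simp⟩ (dir M Γ Δ k) T₁
      (by
        rintro S T₁ T₂ hle ⟨T, hP, h⟩
        exact ⟨T, hP.mono_contEnv (subtype_update_of_subset hle Δ k), h⟩)
      (by
        intro S hS
        obtain ⟨T₁, hP, h⟩ := h S hS
        obtain ⟨T₀, hT₀, hP⟩ := ihP hP
        exact ⟨T₀, hT₀, T₁, hP, h⟩)
    obtain ⟨T₀, hT₀, hle₁, hle₂⟩ := dir M Γ Δ k _ _ hT₂ hT₃
    refine ⟨T₀, hT₀, T₁, hN.mono_contEnv (subtype_update_of_subset hle₁ Δ k), fun S hS => ?_⟩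
    obtain ⟨T₄, hP, h⟩ := h S hS
    exact ⟨T₄, hP.mono_contEnv (subtype_update_of_subset hle₂ Δ k), h⟩
  | letIn L N ihL ihN =>
    obtain ⟨T₁, hN, h⟩ := h
    obtain ⟨T₂, hT₂, hN⟩ := ihN hN
    obtain ⟨T₃, hT₃, h⟩ := exists_forall_mem_of_directed (r := fun T₁ T₂ : Ty A => T₁ ⊆ T₂)
      (Q := fun S T₀ => Assigns L (envCons S Γ) (Function.update Δ k T₀) τ)
      ⟨[], by simp⟩ (dir M Γ Δ k) T₁
      (fun S T₁ T₂ hle h => h.mono_contEnv (subtype_update_of_subset hle Δ k))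
      (by
        intro S hS
        obtain ⟨T₀, hT₀, h⟩ := ihL (h S hS)
        exact ⟨T₀, fun S hS => assigns_weaken_under.1 (hT₀ S hS), h⟩)
    obtain ⟨T₀, hT₀, hle₁, hle₂⟩ := dir M Γ Δ k _ _ hT₂ hT₃
    exact ⟨T₀, hT₀, T₁, hN.mono_contEnv (subtype_update_of_subset hle₁ Δ k),
      fun S hS => (h S hS).mono_contEnv (subtype_update_of_subset hle₂ Δ k)⟩
  | mu J ih =>
    cases τ with | ty T
    obtain ⟨T₀, hT₀, h⟩ := ih (τ := .bot) (Δ := envCons T Δ) h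
    refine ⟨T₀, fun S hS => assigns_shiftK.1 (hT₀ S hS), ?_⟩
    rw [← envCons_update] at h
    exact h
  | jmp l Q ih =>
    cases τ
    by_cases hl : l = k
    · subst hl
      simp only [Expr.capture, if_true] at h
      obtain ⟨T₁, h, hM⟩ := h
      obtain ⟨T₂, hT₂, h⟩ := ih (τ := .ty _) h
      -- `T₁` types the argument of this jump and `T₂` accounts for the jumps nested inside it;
      -- their union does both.
      obtain ⟨T₀, hT₀, hle₁, hle₂⟩ := dir M Γ Δ l _ _ hM hT₂
      refine ⟨T₀, hT₀, ?_⟩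
      simpa [Assigns] using (h.mono_contEnv (subtype_update_of_subset hle₂ Δ l)).mono_ty
        (.of_subset hle₁)
    · simp only [Expr.capture, if_neg hl] at h
      obtain ⟨T₀, hT₀, h⟩ := ih (τ := .ty _) h
      exact ⟨T₀, hT₀, by simpa [Assigns, hl] using h⟩

theorem assigns_capture_iff {J : Expr .jump} {M : Expr .term} {Γ : ℕ → SubTy A}
    {Δ : ℕ → Ty A} {T : Ty A} :
    Assigns (mu (capture 0 (shiftK M) J)) Γ Δ (.ty T) ↔
      Assigns (letIn M (mu J)) Γ Δ (.ty T) := by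
  have hup : ∀ T₀, Function.update (envCons T Δ) 0 T₀ = envCons T₀ Δ := by
    intro T₀
    funext n
    cases n <;> simp [envCons]
  constructor
  · intro h
    obtain ⟨T₀, hM, h⟩ := Assigns.of_capture (τ := .bot) h
    rw [hup] at h
    exact ⟨T₀, h, fun S hS => assigns_shiftK.1 (hM S hS)⟩
  · rintro ⟨T₀, h, hM⟩
    refine Assigns.capture (τ := .bot) (T₀ := T₀) ?_ fun S hS => assigns_shiftK.2 (hM S hS)
    rw [hup]
    exact h

/-! ### The identification of expressions and the reduction rules -/

theorem assigns_letIn_assoc {L M N : Expr .term} {Γ : ℕ → SubTy A} {Δ : ℕ → Ty A}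
    {τ : JTy A .term} : Assigns (letIn L (letIn M N)) Γ Δ τ ↔
      Assigns (letIn (letIn (rename (liftRen Nat.succ) L) M) N) Γ Δ τ := by
  constructor
  · rintro ⟨T₀, ⟨T₁, hN, hM⟩, hL⟩
    exact ⟨T₁, hN, fun S hS => ⟨T₀, hM S hS, fun S' hS' => assigns_weaken_under.2 (hL S' hS')⟩⟩
  · rintro ⟨T₁, hN, h⟩
    choose! f hM hL using h
    -- The type of `M` may depend on the member of `T₁` under consideration; the union of all of
    -- them is independent of it.
    refine ⟨T₁.flatMap f, ⟨T₁, hN, fun S hS => (hM S hS).mono_ty (.of_subset ?_)⟩, ?_⟩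
    · exact fun S' hS' => List.mem_flatMap.2 ⟨S, hS, hS'⟩
    · intro S' hS'
      obtain ⟨S, hS, hS'⟩ := List.mem_flatMap.1 hS'
      exact assigns_weaken_under.1 (hL S hS S' hS')

theorem Eqv.assigns_iff {M N : Expr s} (h : Eqv M N) {Γ : ℕ → SubTy A} {Δ : ℕ → Ty A}
    {τ : JTy A s} : Assigns M Γ Δ τ ↔ Assigns N Γ Δ τ := by
  induction h generalizing Γ Δ with
  | assoc L M N => exact assigns_letIn_assoc
  | muLet J M => cases τ; simp only [Assigns, assigns_shiftK]
  | jmpLet k L M => cases τ; simp only [Assigns]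
  | refl M => exact Iff.rfl
  | symm _ ih => exact ih.symm
  | trans _ _ ih₁ ih₂ => exact ih₁.trans ih₂
  | letIn _ _ ih₁ ih₂ => simp only [Assigns, ih₁, ih₂]
  | _ => cases τ; simp only [Assigns, *]

/-- In both expressions the type of the argument is chosen after a member `S` of the type of the
function. -/
theorem assigns_app_iff_letIn_left {M N : Expr .term} {Γ : ℕ → SubTy A} {Δ : ℕ → Ty A}
    {T : Ty A} : Assigns (app N M) Γ Δ (.ty T) ↔
      Assigns (letIn (app (var 0) (shift M)) N) Γ Δ (.ty T) := by
  simp only [Assigns, assigns_shift]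
  refine exists_congr fun T₀ => and_congr_right fun _ => forall₂_congr fun S _ => ?_
  constructor
  · exact fun h => ⟨[S], .refl _, by simpa using h⟩
  · rintro ⟨T₁, hS, h⟩
    obtain ⟨S₁, hS₁, hle⟩ := sub_subtype_iff.1 hS
    obtain ⟨T₂, hM, h⟩ := h S₁ hS₁
    exact ⟨T₂, hM, fun S₂ hS₂ => Subtype.sub_trans hle (h S₂ hS₂)⟩

/-- A value uses one member of its union, so the argument type can be chosen once; conversely the
required arrows are intersected. -/
theorem assigns_app_value_iff {V N : Expr .term} (hV : IsValue V) {Γ : ℕ → SubTy A}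
    {Δ : ℕ → Ty A} {T : Ty A} : Assigns (app V N) Γ Δ (.ty T) ↔
      ∃ T₁, Assigns N Γ Δ (.ty T₁) ∧ ∀ S₁ ∈ T₁, Assigns V Γ Δ (.ty [[.arrow S₁ T]]) := by
  constructor
  · rintro ⟨T₀, h, hN⟩
    obtain ⟨S, hS, h⟩ := h.exists_mem_of_isValue hV
    obtain ⟨T₁, hN, hle⟩ := hN S hS
    exact ⟨T₁, hN, fun S₁ hS₁ => h.mono_ty (hle S₁ hS₁)⟩
  · rintro ⟨T₁, hN, h⟩
    refine ⟨[T₁.map fun S₁ => .arrow S₁ T], assigns_inter_of_isValue hV (by simpa using h), ?_⟩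
    simp only [List.mem_singleton, forall_eq]
    exact ⟨T₁, hN, fun S₁ hS₁ => .sub_of_mem (List.mem_map_of_mem hS₁)⟩

theorem assigns_app_value_var_iff {V : Expr .term} (hV : IsValue V) {Γ : ℕ → SubTy A}
    {Δ : ℕ → Ty A} {S : SubTy A} {T : Ty A} :
    Assigns (app (shift V) (var 0)) (envCons S Γ) Δ (.ty T) ↔
      Assigns V Γ Δ (.ty [[.arrow S T]]) := by
  rw [assigns_app_value_iff (V := shift V) (isValue_rename hV _)]
  simp only [assigns_shift]
  constructor
  · rintro ⟨T₁, hS, h⟩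
    obtain ⟨S₁, hS₁, hle⟩ := sub_subtype_iff.1 hS
    exact (h S₁ hS₁).mono_ty (.arrow hle (.refl _))
  · exact fun h => ⟨[S], Subtype.refl _, by simpa using h⟩

theorem assigns_app_iff_letIn_right {V N : Expr .term} (hV : IsValue V) {Γ : ℕ → SubTy A}
    {Δ : ℕ → Ty A} {T : Ty A} : Assigns (app V N) Γ Δ (.ty T) ↔
      Assigns (letIn (app (shift V) (var 0)) N) Γ Δ (.ty T) := by
  rw [assigns_app_value_iff hV]
  exact exists_congr fun T₁ => and_congr_right fun _ => forall₂_congr fun S₁ _ =>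
    (assigns_app_value_var_iff hV).symm

theorem assigns_app_lam_iff {M N : Expr .term} {Γ : ℕ → SubTy A} {Δ : ℕ → Ty A} {T : Ty A} :
    Assigns (app (lam M) N) Γ Δ (.ty T) ↔ Assigns (letIn M N) Γ Δ (.ty T) := by
  rw [assigns_app_value_iff (by trivial)]
  exact exists_congr fun T₁ => and_congr_right fun _ => forall₂_congr fun S₁ _ => by
    simp [Assigns]

theorem assigns_letIn_var_iff {M : Expr .term} {Γ : ℕ → SubTy A} {Δ : ℕ → Ty A} {T : Ty A} :
    Assigns (letIn (var 0) M) Γ Δ (.ty T) ↔ Assigns M Γ Δ (.ty T) := by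
  constructor
  · rintro ⟨T₀, hM, h⟩
    exact hM.mono_ty (.of_forall fun S hS => sub_subtype_iff.1 (h S hS))
  · exact fun h => ⟨T, h, fun S hS => .of_mem hS⟩

theorem assigns_jmp_mu_iff {J : Expr .jump} {l : ℕ} {Γ : ℕ → SubTy A} {Δ : ℕ → Ty A} :
    Assigns (jmp l (mu J)) Γ Δ .bot ↔ Assigns (instK l J) Γ Δ .bot := by
  have : (Δ ∘ fun | 0 => l | n + 1 => n) = envCons (Δ l) Δ := by
    funext n; cases n <;> rfl
  rw [instK, assigns_renameK, this]
  rfl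

theorem assigns_of_lam_eta {V : Expr .term} (hV : IsValue V) {Γ : ℕ → SubTy A} {Δ : ℕ → Ty A}
    {T : Ty A} (h : Assigns (lam (app (shift V) (var 0))) Γ Δ (.ty T)) :
    Assigns V Γ Δ (.ty T) := by
  obtain ⟨S, hS, h⟩ := h
  refine Assigns.mono_ty (assigns_inter_of_isValue hV (S := S) fun R hR => ?_)
    (.of_mem hS)
  obtain ⟨S₁, T₁, rfl, h⟩ := h R hR
  exact (assigns_app_value_var_iff hV).1 h

/-- The only place where atoms obstruct expansion: a variable of type `α` has no `η`-expansion of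
type `α`. -/
theorem assigns_lam_eta [IsEmpty A] {V : Expr .term} (hV : IsValue V) {Γ : ℕ → SubTy A}
    {Δ : ℕ → Ty A} {T : Ty A} (h : Assigns V Γ Δ (.ty T)) :
    Assigns (lam (app (shift V) (var 0))) Γ Δ (.ty T) := by
  obtain ⟨S, hS, h⟩ := h.exists_mem_of_isValue hV
  refine ⟨S, hS, fun R hR => ?_⟩
  cases R with
  | atom a => exact isEmptyElim a
  | arrow S₁ T₁ =>
    exact ⟨S₁, T₁, rfl, (assigns_app_value_var_iff hV).2
      (h.mono_ty (.sub_of_mem hR))⟩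

/-- Subject reduction, and subject expansion in the absence of atomic types, for one step. -/
theorem Step.assigns {M N : Expr s} (h : Step M N) {Γ : ℕ → SubTy A} {Δ : ℕ → Ty A}
    {τ : JTy A s} : (Assigns M Γ Δ τ → Assigns N Γ Δ τ) ∧
      (IsEmpty A → Assigns N Γ Δ τ → Assigns M Γ Δ τ) := by
  have of_iff : ∀ {P Q : Prop}, (P ↔ Q) → (P → Q) ∧ (IsEmpty A → Q → P) :=
    fun h => ⟨h.1, fun _ => h.2⟩
  induction h generalizing Γ Δ with
  | ad₁ N M _ => cases τ; exact of_iff assigns_app_iff_letIn_left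
  | ad₂ V N hV _ => cases τ; exact of_iff (assigns_app_iff_letIn_right hV)
  | betaLam M V _ => cases τ; exact of_iff assigns_app_lam_iff
  | betaLet M V hV => exact of_iff (assigns_inst_iff hV).symm
  | betaMu M J => cases τ; exact of_iff assigns_capture_iff.symm
  | betaJmp l J => cases τ; exact of_iff assigns_jmp_mu_iff
  | etaLam V hV =>
    cases τ
    exact ⟨assigns_of_lam_eta hV, fun _ => assigns_lam_eta hV⟩
  | etaLet M => cases τ; exact of_iff assigns_letIn_var_iff
  | etaMu M => cases τ; exact of_iff assigns_shiftK
  | lam _ ih =>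
    cases τ
    constructor
    · rintro ⟨S, hS, h⟩
      refine ⟨S, hS, fun R hR => ?_⟩
      obtain ⟨S₁, T₁, rfl, h⟩ := h R hR
      exact ⟨S₁, T₁, rfl, ih.1 h⟩
    · rintro hA ⟨S, hS, h⟩
      refine ⟨S, hS, fun R hR => ?_⟩
      obtain ⟨S₁, T₁, rfl, h⟩ := h R hR
      exact ⟨S₁, T₁, rfl, ih.2 hA h⟩
  | appL N _ ih =>
    cases τ
    exact ⟨fun ⟨T₀, h, hN⟩ => ⟨T₀, ih.1 h, hN⟩, fun hA ⟨T₀, h, hN⟩ => ⟨T₀, ih.2 hA h, hN⟩⟩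
  | appR M _ ih =>
    cases τ
    constructor
    · rintro ⟨T₀, h, hN⟩
      refine ⟨T₀, h, fun S hS => ?_⟩
      obtain ⟨T₁, hN, hle⟩ := hN S hS
      exact ⟨T₁, ih.1 hN, hle⟩
    · rintro hA ⟨T₀, h, hN⟩
      refine ⟨T₀, h, fun S hS => ?_⟩
      obtain ⟨T₁, hN, hle⟩ := hN S hS
      exact ⟨T₁, ih.2 hA hN, hle⟩
  | letL M _ ih =>
    exact ⟨fun ⟨T₀, h, hL⟩ => ⟨T₀, h, fun S hS => ih.1 (hL S hS)⟩,
      fun hA ⟨T₀, h, hL⟩ => ⟨T₀, h, fun S hS => ih.2 hA (hL S hS)⟩⟩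
  | letR L _ ih =>
    exact ⟨fun ⟨T₀, h, hL⟩ => ⟨T₀, ih.1 h, hL⟩, fun hA ⟨T₀, h, hL⟩ => ⟨T₀, ih.2 hA h, hL⟩⟩
  | mu _ ih => cases τ; exact ih (τ := .bot)
  | jmp k _ ih => cases τ; exact ih (τ := .ty _)

theorem Reduces.assigns {M N : Expr s} (h : Reduces M N) {Γ : ℕ → SubTy A} {Δ : ℕ → Ty A}
    {τ : JTy A s} (hM : Assigns M Γ Δ τ) : Assigns N Γ Δ τ := by
  induction h with
  | refl => exact hM
  | tail _ h ih => exact h.elim (fun h => h.assigns_iff.1 ih) fun h => h.assigns.1 ih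

theorem Reduces.assigns_expand [IsEmpty A] {M N : Expr s} (h : Reduces M N) {Γ : ℕ → SubTy A}
    {Δ : ℕ → Ty A} {τ : JTy A s} (hN : Assigns N Γ Δ τ) : Assigns M Γ Δ τ := by
  induction h with
  | refl => exact hN
  | tail _ h ih =>
    exact ih (h.elim (fun h => h.assigns_iff.2 hN) fun h => h.assigns.2 inferInstance hN)

end Assigns

/-! ### Substitution for atomic types -/

section TypeSubst

variable {A B : Type*} {s : Kind}

/-- Substitution of raw types for the atomic types of a raw type. -/
def RawTy.bind (θ : A → RawTy B) : RawTy A → RawTy B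
  | .atom a => θ a
  | .arrow S T => .arrow (S.map (RawTy.bind θ)) (T.map fun U => U.map (RawTy.bind θ))
termination_by R => sizeOf R
decreasing_by
  · have := List.sizeOf_lt_of_mem ‹_ ∈ S›
    simp; omega
  · have := List.sizeOf_lt_of_mem ‹_ ∈ T›
    have := List.sizeOf_lt_of_mem ‹_ ∈ U›
    simp; omega

/-- Substitution of raw types for the atomic types of a subsidiary type. -/
def subTyBind (θ : A → RawTy B) (S : SubTy A) : SubTy B := S.map (RawTy.bind θ)

/-- Substitution of raw types for the atomic types of a type. -/
def tyBind (θ : A → RawTy B) (T : Ty A) : Ty B := T.map (subTyBind θ)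

theorem RawTy.bind_arrow (θ : A → RawTy B) (S : SubTy A) (T : Ty A) :
    RawTy.bind θ (.arrow S T) = .arrow (subTyBind θ S) (tyBind θ T) := by
  rw [RawTy.bind]; rfl

theorem mem_subTyBind {θ : A → RawTy B} {S : SubTy A} {R : RawTy B} :
    R ∈ subTyBind θ S ↔ ∃ R₀ ∈ S, RawTy.bind θ R₀ = R := List.mem_map

theorem mem_tyBind {θ : A → RawTy B} {T : Ty A} {S : SubTy B} :
    S ∈ tyBind θ T ↔ ∃ S₀ ∈ T, subTyBind θ S₀ = S := List.mem_map

theorem Subtype.bind (θ : A → RawTy B) {T T' : Ty A} (h : Subtype T T') :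
    Subtype (tyBind θ T) (tyBind θ T') := by
  induction h with
  | atom a => exact .refl _
  | arrow _ _ ih₁ ih₂ =>
    simp only [tyBind, subTyBind, List.map_cons, List.map_nil, RawTy.bind_arrow]
    exact .arrow ih₁ ih₂
  | interL hp _ ih => exact .trans (.sub_of_subset (List.map_subset _ hp.subset)) ih
  | @interR S S₀ Ss hp _ ih =>
    refine .sub_of_forall fun R' hR' => ?_
    obtain ⟨R', hR'₀, rfl⟩ := mem_subTyBind.1 hR'
    obtain ⟨S', hS', hR'⟩ := List.mem_flatten.1 (hp.subset hR'₀)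
    exact subtype_sub_iff.1 (ih S' hS') _ (mem_subTyBind.2 ⟨R', hR', rfl⟩)
  | unionR hp _ ih => exact ih.trans (.of_subset (List.map_subset _ hp.subset))
  | unionL Ts hp _ ih =>
    refine .of_forall fun S hS => ?_
    obtain ⟨S, hS₀, rfl⟩ := mem_tyBind.1 hS
    obtain ⟨T, hT, hS⟩ := List.mem_flatten.1 (hp.subset hS₀)
    exact subtype_iff.1 (ih T hT) _ (mem_tyBind.2 ⟨S, hS, rfl⟩)

/-- Substitution of raw types for the atomic types of what an expression is assigned. -/
def JTy.bind (θ : A → RawTy B) : {s : Kind} → JTy A s → JTy B s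
  | _, .ty T => .ty (tyBind θ T)
  | _, .bot => .bot

/-- No clause asks for an atom, and the arrows that abstractions and applications ask for remain
arrows under substitution. -/
theorem Assigns.bind (θ : A → RawTy B) {M : Expr s} {Γ : ℕ → SubTy A} {Δ : ℕ → Ty A}
    {τ : JTy A s} (h : Assigns M Γ Δ τ) :
    Assigns M (fun i => subTyBind θ (Γ i)) (fun k => tyBind θ (Δ k)) (τ.bind θ) := by
  induction M generalizing Γ Δ with
  | var i => cases τ; exact Subtype.bind θ h
  | lam M ih =>
    cases τ
    obtain ⟨S, hS, h⟩ := h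
    refine ⟨_, mem_tyBind.2 ⟨S, hS, rfl⟩, fun R hR => ?_⟩
    obtain ⟨R, hR₀, rfl⟩ := mem_subTyBind.1 hR
    obtain ⟨S₁, T₁, rfl, h⟩ := h R hR₀
    refine ⟨_, _, RawTy.bind_arrow θ S₁ T₁, ?_⟩
    rw [← map_envCons]
    exact ih h
  | app M N ihM ihN =>
    cases τ
    obtain ⟨T₀, hM, h⟩ := h
    refine ⟨tyBind θ T₀, ihM hM, fun S hS => ?_⟩
    obtain ⟨S, hS₀, rfl⟩ := mem_tyBind.1 hS
    obtain ⟨T₁, hN, h⟩ := h S hS₀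
    refine ⟨tyBind θ T₁, ihN hN, fun S₁ hS₁ => ?_⟩
    obtain ⟨S₁, hS₁', rfl⟩ := mem_tyBind.1 hS₁
    rw [← RawTy.bind_arrow]
    exact (h S₁ hS₁').bind θ
  | letIn L N ihL ihN =>
    obtain ⟨T₀, hN, h⟩ := h
    refine ⟨tyBind θ T₀, ihN hN, fun S hS => ?_⟩
    obtain ⟨S, hS₀, rfl⟩ := mem_tyBind.1 hS
    rw [← map_envCons]
    exact ihL (h S hS₀)
  | mu J ih =>
    cases τ
    simp only [JTy.bind, Assigns]
    rw [← map_envCons]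
    exact ih (τ := .bot) h
  | jmp k M ih =>
    cases τ
    exact ih (τ := .ty _) h

theorem Typing.bind (θ : A → RawTy B) {M : Expr s} {Γ : List (SubTy A)} {Δ : List (Ty A)}
    {τ : JTy A s} (h : Typing Γ M τ Δ) :
    Typing (Γ.map (subTyBind θ)) M (τ.bind θ) (Δ.map (tyBind θ)) := by
  refine Assigns.typing ?_
  have hΓ : (fun i => (Γ.map (subTyBind θ)).getD i []) = fun i => subTyBind θ (Γ.getD i []) := by
    funext i
    exact List.getD_map (d := []) ..
  have hΔ : (fun k => (Δ.map (tyBind θ)).getD k []) = fun k => tyBind θ (Δ.getD k []) := by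
    funext k
    exact List.getD_map (d := []) ..
  rw [hΓ, hΔ]
  exact h.assigns.bind θ

end TypeSubst

end CCV

/-! ### Subject reduction and subject expansion -/

theorem mainTheorem6 {A : Type*} (L M : CCV.Expr CCV.Kind.term) (h : CCV.Reduces L M) :
    (∀ (Γ : List (CCV.SubTy A)) (T : CCV.Ty A) (Δ : List (CCV.Ty A)),
      CCV.Typing Γ L (CCV.JTy.ty T) Δ → CCV.Typing Γ M (CCV.JTy.ty T) Δ) ∧
    (∀ (Γ : List (CCV.SubTy A)) (T : CCV.Ty A) (Δ : List (CCV.Ty A)),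
      CCV.Typing Γ M (CCV.JTy.ty T) Δ →
      ∃ (Γ' : List (CCV.SubTy A)) (T' : CCV.Ty A) (Δ' : List (CCV.Ty A)),
        CCV.Typing Γ' L (CCV.JTy.ty T') Δ') := by
  refine ⟨fun Γ T Δ hL => (h.assigns hL.assigns).typing, fun Γ T Δ hM => ?_⟩
  -- Every atom becomes the arrow from `ω` to the empty union, a raw type that contains no atoms.
  have hM' := hM.bind (B := Empty) fun _ => .arrow [] []
  have hL : CCV.Typing _ L _ _ := (h.assigns_expand hM'.assigns).typing
  -- Types without atoms are types over any `A`.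
  exact ⟨_, _, _, hL.bind (B := A) Empty.elim⟩
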